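/- Let $C_1,\dots,C_N$ be commuting elements of the $n$-qubit Pauli group $\mathcal P_n$ (the group generated by all $n$-fold tensor products of $I,X,Y,Z$), defining a stabilizer code. Let $\mathcal S$ be the group generated by the $C_i$, for $s\in\{0,1\}^N$ let $$D_s=\{|v\rangle\in(\mathbb C^2)^{\otimes n}: C_i|v\rangle=(-1)^{s_i}|v\rangle\ \text{for all } i\},$$ and let the logical operators be the elements of $\mathcal P_n$ that commute with every $C_i$ but do not lie in $\mathcal S$. Let $\overline X,\overline Z$ be a logical Pauli pair, that is, two anti-commuting logical operators with $\overline X^2=\overline Z^2=\mathrm{id}$. The weight of an operator is the number of qubits on which it acts non-trivially. Let $w$ be the maximum of the weights of $\overline X$ and $\overline Z$, and let $d'$ be the smallest weight of a logical operator that anti-commutes with $\overline X$ or with $\overline Z$. (The largest value of $d'$ over all logical pairs is the best distance of the code.) Let $m\ge n$ and let $|\psi\rangle=U|0\rangle^{\otimes m}$ be a state on the $n$ code qubits and $m-n$ ancilla qubits, where $U$ is a circuit of depth $t$ (it has $t$ layers, each a tensor product of unitary gates on disjoint sets of at most two qubits, with all-to-all connectivity), and suppose that $t\le\log_2\frac{d'}{2}$.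 Let $\psi_{\mathsf{code}}$ be the reduced state of $\psi=|\psi\rangle\langle\psi|$ on the code qubits. Then for every $s\in\{0,1\}^N$ and every (possibly mixed) state $\rho_{\mathsf{code}}$ on the $n$ code qubits that is supported on $D_s$, $$\frac12\left\|\psi_{\mathsf{code}}-\rho_{\mathsf{code}}\right\|_1\ \ge\ \frac12\left(\frac{d'}{2^{2t+6}\,w}\right)^2,$$ where $\|\cdot\|_1$ is the trace norm. -/

import Mathlib

open scoped ComplexOrder

namespace QCode

noncomputable section

/-- Computational basis labels of a register of qubits indexed by `ι`. -/
abbrev Bits (ι : Type*) := ι → Fin 2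

/-- Vectors of the Hilbert space `(ℂ²)^{⊗ι}`, in the computational basis. -/
abbrev Ket (ι : Type*) := Bits ι → ℂ

/-- Operators on `(ℂ²)^{⊗ι}`, in the computational basis. -/
abbrev Op (ι : Type*) := Matrix (Bits ι) (Bits ι) ℂ

/-- The unitary operators on `(ℂ²)^{⊗ι}`. -/
abbrev UOp (ι : Type*) [Fintype ι] [DecidableEq ι] := Matrix.unitaryGroup (Bits ι) ℂ

/-! ### Operators acting on part of a register, and weight -/

/-- The operator `A ⊗ id` on the register `ι`, where `A` acts on the qubits in `S`. -/
def embed {ι : Type*} [Fintype ι] [DecidableEq ι] (S : Finset ι) (A : Op S) : Op ι :=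
  fun x y => if ∀ i, i ∉ S → x i = y i then A (fun i => x i) (fun i => y i) else 0

/-- `M` acts as the identity outside `S`. -/
def SupportedOn {ι : Type*} [Fintype ι] [DecidableEq ι] (S : Finset ι) (M : Op ι) : Prop :=
  ∃ A : Op S, M = embed S A

/-- The weight of an operator: the number of qubits on which it acts non-trivially, that is,
the size of the smallest set of qubits on which it is supported. -/
def weight {ι : Type*} [Fintype ι] [DecidableEq ι] (M : Op ι) : ℕ :=
  sInf {k | ∃ S : Finset ι, S.card = k ∧ SupportedOn S M}

/-! ### Pauli operators -/

/-- Labels of the four Pauli matrices. -/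
inductive Pauli
  | I | X | Y | Z

/-- The Pauli matrices. -/
def Pauli.mat : Pauli → Matrix (Fin 2) (Fin 2) ℂ
  | .I => 1
  | .X => !![0, 1; 1, 0]
  | .Y => !![0, -Complex.I; Complex.I, 0]
  | .Z => !![1, 0; 0, -1]

/-- The tensor product of the Pauli matrices `p i`, as a matrix. -/
def pauliMat {ι : Type*} [Fintype ι] (p : ι → Pauli) : Op ι :=
  fun x y => ∏ i, (p i).mat (x i) (y i)

theorem Pauli.mat_mul_star (p : Pauli) : p.mat * star p.mat = 1 := by
  cases p <;> ext i j <;> fin_cases i <;> fin_cases j <;>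
    simp [Pauli.mat, Matrix.mul_apply, Fin.sum_univ_two, Matrix.star_apply]

theorem pauliMat_mem_unitary {ι : Type*} [Fintype ι] [DecidableEq ι] (p : ι → Pauli) :
    pauliMat p ∈ Matrix.unitaryGroup (Bits ι) ℂ := by
  rw [Matrix.mem_unitaryGroup_iff]
  ext x y
  have h : ∀ i, ∑ b, (p i).mat (x i) b * star ((p i).mat (y i) b)
      = (1 : Matrix (Fin 2) (Fin 2) ℂ) (x i) (y i) := by
    intro i
    rw [← Pauli.mat_mul_star (p i), Matrix.mul_apply]
    rfl
  simp only [Matrix.mul_apply, Matrix.star_apply, pauliMat]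
  simp only [star_prod, ← Finset.prod_mul_distrib]
  rw [← Fintype.prod_sum (fun i b => (p i).mat (x i) b * star ((p i).mat (y i) b))]
  simp only [h, Matrix.one_apply]
  rw [Finset.prod_ite_zero]
  simp [funext_iff]

/-- The tensor product of the Pauli matrices `p i`, as a unitary operator. -/
def pauliTensor {ι : Type*} [Fintype ι] [DecidableEq ι] (p : ι → Pauli) : UOp ι :=
  ⟨pauliMat p, pauliMat_mem_unitary p⟩

/-- The Pauli group: the group generated by all tensor products of Pauli matrices. -/
def pauliGroup (ι : Type*) [Fintype ι] [DecidableEq ι] : Subgroup (UOp ι) :=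
  Subgroup.closure (Set.range pauliTensor)

/-! ### Stabilizer codes -/

/-- A stabilizer code on `n` qubits: a family of `N` commuting Pauli operators. -/
structure StabilizerCode (n N : ℕ) where
  check : Fin N → UOp (Fin n)
  check_mem : ∀ i, check i ∈ pauliGroup (Fin n)
  check_comm : ∀ i j, Commute (check i) (check j)

namespace StabilizerCode

variable {n N : ℕ} (𝒞 : StabilizerCode n N)

/-- The stabilizer group, generated by the checks. -/
def stabilizer : Subgroup (UOp (Fin n)) :=
  Subgroup.closure (Set.range 𝒞.check)

/-- The syndrome space `D_s` (the code space is `D_0`). -/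
def syndromeSpace (s : Fin N → Fin 2) : Submodule ℂ (Ket (Fin n)) where
  carrier := {v | ∀ i, (𝒞.check i : Op (Fin n)).mulVec v = (-1 : ℂ) ^ (s i : ℕ) • v}
  add_mem' {a b} ha hb i := by rw [Matrix.mulVec_add, ha i, hb i, smul_add]
  zero_mem' i := by simp
  smul_mem' c v hv i := by rw [Matrix.mulVec_smul, hv i, smul_comm]

/-- The logical operators: Pauli operators that commute with every check but do not belong to
the stabilizer group. -/
def logicalOps : Set (UOp (Fin n)) :=
  {P | P ∈ pauliGroup (Fin n) ∧ ∀ i, Commute P (𝒞.check i)} \ 𝒞.stabilizer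

end StabilizerCode

/-- Two operators anti-commute. -/
def AntiCommute {ι : Type*} [Fintype ι] [DecidableEq ι] (P Q : UOp ι) : Prop :=
  (P : Op ι) * (Q : Op ι) = -((Q : Op ι) * (P : Op ι))

namespace StabilizerCode

variable {n N : ℕ} (𝒞 : StabilizerCode n N)

/-- A logical Pauli pair `X̄, Z̄`: anti-commuting logical operators that square to the
identity. -/
structure IsLogicalPair (X Z : UOp (Fin n)) : Prop where
  left_mem : X ∈ 𝒞.logicalOps
  right_mem : Z ∈ 𝒞.logicalOps
  left_sq : X * X = 1
  right_sq : Z * Z = 1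
  anti : AntiCommute X Z

/-- The distance `d'` of a pair `X̄, Z̄`: the smallest weight of a logical operator that
anti-commutes with `X̄` or with `Z̄`. -/
def pairDistance (X Z : UOp (Fin n)) : ℕ :=
  sInf {k | ∃ P ∈ 𝒞.logicalOps, (AntiCommute P X ∨ AntiCommute P Z) ∧
    weight (P : Op (Fin n)) = k}

end StabilizerCode

/-- The weight `w` of a pair `X̄, Z̄`: the larger of the two weights. -/
def pairWeight {n : ℕ} (X Z : UOp (Fin n)) : ℕ :=
  max (weight (X : Op (Fin n))) (weight (Z : Op (Fin n)))

/-! ### Circuits -/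

/-- A gate: a unitary operator acting on (at most) two of the qubits. -/
structure Gate (ι : Type*) [Fintype ι] [DecidableEq ι] where
  qubits : Finset ι
  card_le : qubits.card ≤ 2
  unitary : UOp qubits

/-- A layer of a circuit: gates acting on pairwise disjoint sets of qubits. -/
structure Layer (ι : Type*) [Fintype ι] [DecidableEq ι] where
  gates : List (Gate ι)
  disjoint : gates.Pairwise fun g h => Disjoint g.qubits h.qubits

/-- The operator of a layer: the tensor product of its gates, with the identity on all other
qubits. -/
def Layer.op {ι : Type*} [Fintype ι] [DecidableEq ι] (L : Layer ι) : Op ι :=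
  (L.gates.map fun g => embed g.qubits (g.unitary : Op g.qubits)).prod

/-- A circuit is the list of its layers, in the order in which they are applied; its depth is
the length of the list. -/
abbrev Circuit (ι : Type*) [Fintype ι] [DecidableEq ι] := List (Layer ι)

/-- The depth of a circuit. -/
def Circuit.depth {ι : Type*} [Fintype ι] [DecidableEq ι] (U : Circuit ι) : ℕ := List.length U

/-- The operator `U_t ⋯ U_1` of a circuit with layers `U_1, …, U_t`. -/
def Circuit.op {ι : Type*} [Fintype ι] [DecidableEq ι] : Circuit ι → Op ι
  | [] => 1
  | L :: U => Circuit.op U * L.op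

/-! ### States -/

/-- The basis vector `|0⟩^{⊗ι}`. -/
def zeroKet (ι : Type*) [Fintype ι] [DecidableEq ι] : Ket ι := Pi.single 0 1

/-- The operator `|v⟩⟨v|`. -/
def ketbra {ι : Type*} (v : Ket ι) : Op ι := Matrix.vecMulVec v (star v)

/-- A (mixed) quantum state: a positive semidefinite operator of trace one. -/
def IsState {ι : Type*} [Fintype ι] [DecidableEq ι] (ρ : Op ι) : Prop :=
  ρ.PosSemidef ∧ ρ.trace = 1

/-- The reduced operator on the code qubits `ι`: the partial trace over the ancillas `κ`. -/
def codeMarginal {ι κ : Type*} [Fintype κ] [DecidableEq κ] (ρ : Op (ι ⊕ κ)) : Op ι :=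
  fun x y => ∑ z : Bits κ, ρ (Sum.elim x z) (Sum.elim y z)

/-- The state `ρ` lies in the subspace `D`: its range is contained in `D`. -/
def LiesIn {ι : Type*} [Fintype ι] [DecidableEq ι] (ρ : Op ι) (D : Submodule ℂ (Ket ι)) : Prop :=
  ∀ v : Ket ι, ρ.mulVec v ∈ D

/-- The trace norm: the sum of the singular values, the square roots of the eigenvalues of
`Aᴴ A`. -/
def traceNorm {ι : Type*} [Fintype ι] [DecidableEq ι] (A : Op ι) : ℝ :=
  ∑ i, √((Matrix.isHermitian_conjTranspose_mul_self A).eigenvalues i)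

end

end QCode

namespace QCode

noncomputable section

set_option linter.unusedSectionVars false

open Matrix
open scoped Kronecker

/-! ### Products of Pauli operators -/

/-! Put φ = U|0⟩, T = 2^t, d = d', and let v be the projection of φ onto D_s ⊗ (ancillas). If P
projects onto D_s, then tr(P(ψ_code − ρ)) = −‖φ − v‖², so δ = ‖φ − v‖² is at most the trace norm
(`exists_near_syndrome`), and it suffices to bound δ from below.

Let O be X̄ or Z̄. Fewer than d qubits cannot distinguish Ov from v (`expectation_conj_logical`). A
Pauli operator on them that anti-commutes with some check has expectation zero in both vectors. One
that commutes with all checks also commutes with O, since otherwise it would be a logical operator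
of weight below d.

Conjugation by U or U† enlarges supports by a factor of at most T. If Tk < d, the test "the k qubits
of A are all 0", pushed through U, therefore has the same statistics on Ov as on v. Hence for E =
U†OU the vector E|0⟩ fails this test with probability at most 4δ. But E acts on at most Tw qubits.
Covering these with blocks of size k, a union bound shows that E|0⟩ is nearly proportional to |0⟩:
|⟨0|E|0⟩|² ≥ 1 − 4δ(Tw/k + 1) (`one_sub_le_normSq_logical`).

For X̄ and Z̄ the two operators E are anti-commuting reflections, which cannot both have almost
deterministic values in |0⟩ (`normSq_add_normSq_le_one`). With k about d/T this forces δ ≥ d/(32 T²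
w), a linear bound that implies the quadratic one (`sq_le_of_uncertainty`). -/

/-- The sign `±1` with which two Pauli matrices commute. -/
def Pauli.sgn : Pauli → Pauli → ℂ
  | .I, _ => 1
  | _, .I => 1
  | .X, .X => 1
  | .Y, .Y => 1
  | .Z, .Z => 1
  | _, _ => -1

theorem Pauli.sgn_eq (p q : Pauli) : p.sgn q = 1 ∨ p.sgn q = -1 := by
  cases p <;> cases q <;> simp [Pauli.sgn]

theorem Pauli.sgn_I (p : Pauli) : p.sgn .I = 1 := by
  cases p <;> rfl

theorem Pauli.mat_mul_comm (p q : Pauli) : p.mat * q.mat = p.sgn q • (q.mat * p.mat) := by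
  cases p <;> cases q <;> ext i j <;> fin_cases i <;> fin_cases j <;>
    simp [Pauli.mat, Pauli.sgn, Matrix.mul_apply, Fin.sum_univ_two]

/-- The last clause is what later makes `localOps` closed under products. -/
theorem Pauli.exists_mat_mul (p q : Pauli) :
    ∃ (r : Pauli) (c : ℂ), p.mat * q.mat = c • r.mat ∧ (p = .I → q = .I → r = .I) := by
  have key : ∃ r : Pauli, (∃ c : ℂ, p.mat * q.mat = c • r.mat) ∧ (p = .I → q = .I → r = .I) := by
    cases p <;> cases q
    case I.I => exact ⟨.I, ⟨1, by simp [Pauli.mat]⟩, by simp⟩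
    case I.X => exact ⟨.X, ⟨1, by simp [Pauli.mat]⟩, by simp⟩
    case I.Y => exact ⟨.Y, ⟨1, by simp [Pauli.mat]⟩, by simp⟩
    case I.Z => exact ⟨.Z, ⟨1, by simp [Pauli.mat]⟩, by simp⟩
    case X.I => exact ⟨.X, ⟨1, by simp [Pauli.mat]⟩, by simp⟩
    case Y.I => exact ⟨.Y, ⟨1, by simp [Pauli.mat]⟩, by simp⟩
    case Z.I => exact ⟨.Z, ⟨1, by simp [Pauli.mat]⟩, by simp⟩
    case X.X => exact ⟨.I, ⟨1, by simp [Pauli.mat, Matrix.one_fin_two]⟩, by simp⟩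
    case Y.Y => exact ⟨.I, ⟨1, by simp [Pauli.mat, Matrix.one_fin_two]⟩, by simp⟩
    case Z.Z => exact ⟨.I, ⟨1, by simp [Pauli.mat, Matrix.one_fin_two]⟩, by simp⟩
    case X.Y => exact ⟨.Z, ⟨Complex.I, by simp [Pauli.mat]⟩, by simp⟩
    case Y.X => exact ⟨.Z, ⟨-Complex.I, by simp [Pauli.mat]⟩, by simp⟩
    case Y.Z => exact ⟨.X, ⟨Complex.I, by simp [Pauli.mat]⟩, by simp⟩
    case Z.Y => exact ⟨.X, ⟨-Complex.I, by simp [Pauli.mat]⟩, by simp⟩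
    case X.Z => exact ⟨.Y, ⟨-Complex.I, by simp [Pauli.mat]⟩, by simp⟩
    case Z.X => exact ⟨.Y, ⟨Complex.I, by simp [Pauli.mat]⟩, by simp⟩
  obtain ⟨r, ⟨c, h⟩, h'⟩ := key
  exact ⟨r, c, h, h'⟩

theorem Pauli.star_mat (p : Pauli) (a b : Fin 2) : star (p.mat a b) = p.mat b a := by
  cases p <;> fin_cases a <;> fin_cases b <;> simp [Pauli.mat]

/-- The Pauli matrices form an orthogonal basis of the `2 × 2` matrices. -/
theorem Pauli.sum_mat (a b c d : Fin 2) :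
    (Pauli.I.mat b a * Pauli.I.mat c d + Pauli.X.mat b a * Pauli.X.mat c d
      + Pauli.Y.mat b a * Pauli.Y.mat c d + Pauli.Z.mat b a * Pauli.Z.mat c d)
      = if a = c ∧ b = d then 2 else 0 := by
  fin_cases a <;> fin_cases b <;> fin_cases c <;> fin_cases d <;> simp [Pauli.mat] <;> norm_num

instance : Fintype Pauli where
  elems := ⟨([.I, .X, .Y, .Z] : List Pauli), by simp⟩
  complete p := by cases p <;> simp

theorem Pauli.sum_univ (f : Pauli → ℂ) : ∑ p, f p = f .I + f .X + f .Y + f .Z := by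
  change (Multiset.map f (Multiset.ofList ([.I, .X, .Y, .Z] : List Pauli))).sum = _
  simp [add_assoc]

section

variable {ι : Type*} [Fintype ι] [DecidableEq ι]

/-- The sign `±1` with which two Pauli operators commute. -/
def pauliSgn (p q : ι → Pauli) : ℂ := ∏ i, (p i).sgn (q i)

theorem pauliSgn_eq (p q : ι → Pauli) : pauliSgn p q = 1 ∨ pauliSgn p q = -1 := by
  unfold pauliSgn
  refine Finset.prod_induction _ (fun z : ℂ => z = 1 ∨ z = -1) ?_ (Or.inl rfl)
    fun i _ => Pauli.sgn_eq _ _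
  rintro a b (rfl | rfl) (rfl | rfl) <;> simp

theorem pauliMat_mul_apply (p q : ι → Pauli) (x y : Bits ι) :
    (pauliMat p * pauliMat q) x y = ∏ i, ((p i).mat * (q i).mat) (x i) (y i) := by
  simp only [Matrix.mul_apply, pauliMat, ← Finset.prod_mul_distrib]
  rw [← Fintype.prod_sum (fun i b => (p i).mat (x i) b * (q i).mat b (y i))]

theorem pauliMat_mul_comm (p q : ι → Pauli) :
    pauliMat p * pauliMat q = pauliSgn p q • (pauliMat q * pauliMat p) := by
  ext x y
  rw [Matrix.smul_apply, pauliMat_mul_apply, pauliMat_mul_apply, pauliSgn, smul_eq_mul,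
    ← Finset.prod_mul_distrib]
  refine Finset.prod_congr rfl fun i _ => ?_
  rw [Pauli.mat_mul_comm, Matrix.smul_apply, smul_eq_mul]

theorem exists_pauliMat_mul (p q : ι → Pauli) :
    ∃ (r : ι → Pauli) (c : ℂ), pauliMat p * pauliMat q = c • pauliMat r ∧
      ∀ i, p i = .I → q i = .I → r i = .I := by
  choose r c h h' using fun i => Pauli.exists_mat_mul (p i) (q i)
  refine ⟨r, ∏ i, c i, ?_, h'⟩
  ext x y
  rw [Matrix.smul_apply, pauliMat_mul_apply, pauliMat, smul_eq_mul, ← Finset.prod_mul_distrib]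
  refine Finset.prod_congr rfl fun i _ => ?_
  rw [h, Matrix.smul_apply, smul_eq_mul]

theorem pauliMat_conjTranspose (p : ι → Pauli) : (pauliMat p)ᴴ = pauliMat p := by
  ext x y
  simp only [Matrix.conjTranspose_apply, pauliMat, star_prod, Pauli.star_mat]

theorem pauliMat_I : pauliMat (fun _ : ι => Pauli.I) = 1 := by
  ext x y
  simp only [pauliMat, Pauli.mat, Matrix.one_apply]
  rw [Finset.prod_ite_zero]
  simp [funext_iff]

/-- The sum over Pauli strings factorises over the qubits, reducing to `Pauli.sum_mat`. It exhibits
every matrix unit as a combination of Pauli operators. -/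
theorem sum_pauliMat (x y : Bits ι) :
    ∑ p : ι → Pauli, pauliMat p y x • pauliMat p
      = (2 : ℂ) ^ Fintype.card ι • Matrix.single x y (1 : ℂ) := by
  ext a b
  rw [Matrix.sum_apply, Matrix.smul_apply]
  simp only [Matrix.smul_apply, smul_eq_mul, pauliMat, ← Finset.prod_mul_distrib]
  rw [← Fintype.prod_sum (fun i (p : Pauli) => p.mat (y i) (x i) * p.mat (a i) (b i))]
  simp only [Pauli.sum_univ, Pauli.sum_mat]
  rw [Finset.prod_ite_zero]
  simp [Matrix.single_apply, funext_iff, forall_and, Finset.card_univ]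

theorem span_range_pauliMat : Submodule.span ℂ (Set.range (pauliMat (ι := ι))) = ⊤ := by
  rw [eq_top_iff]
  intro M _
  rw [Matrix.matrix_eq_sum_single M]
  refine Submodule.sum_mem _ fun x _ => Submodule.sum_mem _ fun y _ => ?_
  have h : Matrix.single x y (M x y)
      = (M x y * ((2 : ℂ) ^ Fintype.card ι)⁻¹) • ∑ p : ι → Pauli, pauliMat p y x • pauliMat p := by
    rw [sum_pauliMat, smul_smul, mul_assoc, inv_mul_cancel₀ (by positivity), mul_one,
      Matrix.smul_single, smul_eq_mul, mul_one]
  rw [h]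
  exact Submodule.smul_mem _ _ (Submodule.sum_mem _ fun p _ =>
    Submodule.smul_mem _ _ (Submodule.subset_span ⟨p, rfl⟩))

/-! ### Operators local to a set of qubits -/

/-- The span of the Pauli operators that act as the identity outside `S`. -/
def localOps (S : Finset ι) : Submodule ℂ (Op ι) :=
  Submodule.span ℂ (pauliMat '' {p | ∀ i, i ∉ S → p i = .I})

theorem pauliMat_mem_localOps {S : Finset ι} {p : ι → Pauli} (h : ∀ i, i ∉ S → p i = .I) :
    pauliMat p ∈ localOps S :=
  Submodule.subset_span ⟨p, h, rfl⟩

theorem localOps_mono {S T : Finset ι} (h : S ⊆ T) : localOps S ≤ localOps T :=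
  Submodule.span_mono (Set.image_mono fun _ hp i hi => hp i fun hS => hi (h hS))

theorem one_mem_localOps (S : Finset ι) : (1 : Op ι) ∈ localOps S :=
  pauliMat_I (ι := ι) ▸ pauliMat_mem_localOps fun _ _ => rfl

theorem mul_mem_localOps {S : Finset ι} {M N : Op ι} (hM : M ∈ localOps S)
    (hN : N ∈ localOps S) : M * N ∈ localOps S := by
  induction hM, hN using Submodule.span_induction₂ with
  | mem_mem x y hx hy =>
    obtain ⟨p, hp, rfl⟩ := hx
    obtain ⟨q, hq, rfl⟩ := hy
    obtain ⟨r, c, h, hr⟩ := exists_pauliMat_mul p q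
    rw [h]
    exact Submodule.smul_mem _ _ (pauliMat_mem_localOps fun i hi => hr i (hp i hi) (hq i hi))
  | zero_left => simp
  | zero_right => simp
  | add_left x y z _ _ _ hx hy => rw [add_mul]; exact Submodule.add_mem _ hx hy
  | add_right x y z _ _ _ hx hy => rw [mul_add]; exact Submodule.add_mem _ hx hy
  | smul_left r x y _ _ h => rw [smul_mul_assoc]; exact Submodule.smul_mem _ _ h
  | smul_right r x y _ _ h => rw [mul_smul_comm]; exact Submodule.smul_mem _ _ h

theorem conjTranspose_mem_localOps {S : Finset ι} {M : Op ι} (hM : M ∈ localOps S) :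
    Mᴴ ∈ localOps S := by
  induction hM using Submodule.span_induction with
  | mem x hx =>
    obtain ⟨p, hp, rfl⟩ := hx
    rw [pauliMat_conjTranspose]
    exact pauliMat_mem_localOps hp
  | zero => simp
  | add x y _ _ hx hy => rw [conjTranspose_add]; exact Submodule.add_mem _ hx hy
  | smul r x _ h => rw [conjTranspose_smul]; exact Submodule.smul_mem _ _ h

/-- For Pauli operators with disjoint supports, one factor is the identity at every qubit, so the
sign is 1; bilinearity does the rest. -/
theorem commute_of_mem_localOps {S T : Finset ι} (hST : Disjoint S T) {M N : Op ι}
    (hM : M ∈ localOps S) (hN : N ∈ localOps T) : Commute M N := by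
  induction hM, hN using Submodule.span_induction₂ with
  | mem_mem x y hx hy =>
    obtain ⟨p, hp, rfl⟩ := hx
    obtain ⟨q, hq, rfl⟩ := hy
    have h : pauliSgn p q = 1 := by
      refine Finset.prod_eq_one fun i _ => ?_
      by_cases hi : i ∈ S
      · rw [hq i (Finset.disjoint_left.1 hST hi), Pauli.sgn_I]
      · rw [hp i hi, Pauli.sgn]
    rw [Commute, SemiconjBy, pauliMat_mul_comm, h, one_smul]
  | zero_left => exact Commute.zero_left _
  | zero_right => exact Commute.zero_right _
  | add_left x y z _ _ _ hx hy => exact hx.add_left hy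
  | add_right x y z _ _ _ hx hy => exact hx.add_right hy
  | smul_left r x y _ _ h => exact h.smul_left r
  | smul_right r x y _ _ h => exact h.smul_right r

/-! ### Embedded operators -/

theorem embed_eq_submatrix (S : Finset ι) (A : Op S) :
    embed S A = (A ⊗ₖ (1 : Matrix ({i // i ∉ S} → Fin 2) ({i // i ∉ S} → Fin 2) ℂ)).submatrix
      (Equiv.piEquivPiSubtypeProd (· ∈ S) fun _ => Fin 2)
      (Equiv.piEquivPiSubtypeProd (· ∈ S) fun _ => Fin 2) := by
  ext x y
  simp [embed, Matrix.one_apply, funext_iff, Equiv.piEquivPiSubtypeProd]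

theorem embed_mul (S : Finset ι) (A B : Op S) : embed S A * embed S B = embed S (A * B) := by
  rw [embed_eq_submatrix, embed_eq_submatrix, embed_eq_submatrix, Matrix.submatrix_mul_equiv,
    ← Matrix.mul_kronecker_mul, mul_one]

theorem embed_one (S : Finset ι) : embed S (1 : Op S) = 1 := by
  rw [embed_eq_submatrix, Matrix.one_kronecker_one, Matrix.submatrix_one_equiv]

theorem embed_conjTranspose (S : Finset ι) (A : Op S) : (embed S A)ᴴ = embed S Aᴴ := by
  rw [embed_eq_submatrix, embed_eq_submatrix, Matrix.conjTranspose_submatrix,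
    Matrix.conjTranspose_kronecker, Matrix.conjTranspose_one]

/-- The operator `A ⊗ id` depends linearly on `A`. -/
def embedLinear (S : Finset ι) : Op S →ₗ[ℂ] Op ι where
  toFun := embed S
  map_add' A B := by ext x y; simp only [embed, Matrix.add_apply]; split_ifs <;> simp
  map_smul' c A := by ext x y; simp only [embed, Matrix.smul_apply]; split_ifs <;> simp

theorem embed_pauliMat (S : Finset ι) (p : ι → Pauli) (hp : ∀ i, i ∉ S → p i = .I) :
    embed S (pauliMat fun i : S => p i) = pauliMat p := by
  ext x y
  simp only [embed, pauliMat]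
  rw [← Fintype.prod_subtype_mul_prod_subtype (· ∈ S) fun i => (p i).mat (x i) (y i)]
  have h : ∏ i : {i // i ∉ S}, (p i).mat (x i) (y i)
      = if ∀ i, i ∉ S → x i = y i then 1 else 0 := by
    rw [Finset.prod_congr rfl fun i _ => by rw [hp i.1 i.2]]
    simp only [Pauli.mat, Matrix.one_apply]
    rw [Finset.prod_ite_zero]
    simp
  rw [h]
  split_ifs
  · rw [mul_one]
    exact Finset.prod_congr (by ext; simp) fun _ _ => rfl
  · rw [mul_zero]

/-- Links gates and weights to Pauli spans: the Pauli operators on S span everything, and each of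
them embeds as a Pauli operator that is trivial outside S. -/
theorem embed_mem_localOps (S : Finset ι) (A : Op S) : embed S A ∈ localOps S := by
  have h : A ∈ Submodule.span ℂ (Set.range (pauliMat (ι := S))) := by
    rw [span_range_pauliMat]; trivial
  change embedLinear S A ∈ _
  induction h using Submodule.span_induction with
  | mem x hx =>
    obtain ⟨p, rfl⟩ := hx
    have := embed_pauliMat S (fun i => if h : i ∈ S then p ⟨i, h⟩ else .I) fun i hi => by simp [hi]
    have hp : (fun i : S => if h : (i : ι) ∈ S then p ⟨i, h⟩ else .I) = p := by
      funext i; simp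
    rw [hp] at this
    change embed S (pauliMat p) ∈ _
    rw [this]
    exact pauliMat_mem_localOps fun i hi => by simp [hi]
  | zero => simp
  | add x y _ _ hx hy => rw [map_add]; exact Submodule.add_mem _ hx hy
  | smul r x _ h => rw [map_smul]; exact Submodule.smul_mem _ _ h

theorem exists_mem_localOps_card_eq_weight (M : Op ι) :
    ∃ S : Finset ι, S.card = weight M ∧ M ∈ localOps S := by
  have hne : {k | ∃ S : Finset ι, S.card = k ∧ SupportedOn S M}.Nonempty := by
    refine ⟨_, Finset.univ, rfl, fun x y => M (fun i => x ⟨i, Finset.mem_univ i⟩)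
      (fun i => y ⟨i, Finset.mem_univ i⟩), ?_⟩
    ext x y
    simp [embed]
  obtain ⟨S, hS, A, rfl⟩ := Nat.sInf_mem hne
  exact ⟨S, hS, embed_mem_localOps S A⟩

theorem weight_pauliMat_le {S : Finset ι} {p : ι → Pauli} (hp : ∀ i, i ∉ S → p i = .I) :
    weight (pauliMat p) ≤ S.card :=
  Nat.sInf_le ⟨S, rfl, _, (embed_pauliMat S p hp).symm⟩

/-! ### Elements of the Pauli group -/

theorem exists_eq_smul_pauliMat {P : UOp ι} (hP : P ∈ pauliGroup ι) :
    ∃ (c : ℂ) (p : ι → Pauli), (P : Op ι) = c • pauliMat p := by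
  induction hP using Subgroup.closure_induction with
  | mem x hx => obtain ⟨p, rfl⟩ := hx; exact ⟨1, p, by simp [pauliTensor]⟩
  | one => exact ⟨1, fun _ => .I, by simp [pauliMat_I]⟩
  | mul x y _ _ hx hy =>
    obtain ⟨c, p, hp⟩ := hx
    obtain ⟨d, q, hq⟩ := hy
    obtain ⟨r, e, h, -⟩ := exists_pauliMat_mul p q
    exact ⟨c * d * e, r, by
      rw [Submonoid.coe_mul, hp, hq, smul_mul_smul_comm, h, smul_smul]⟩
  | inv x _ hx =>
    obtain ⟨c, p, hp⟩ := hx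
    refine ⟨star c, p, ?_⟩
    change star (x : Op ι) = _
    rw [hp, Matrix.star_eq_conjTranspose, conjTranspose_smul,
      pauliMat_conjTranspose]

end

/-! ### Adding ancillas and tracing them out. -/

section

variable {ι κ : Type*} [Fintype ι] [DecidableEq ι] [Fintype κ] [DecidableEq κ]

/-- The operator `A ⊗ id` on the register `ι ⊕ κ`. -/
def lift (κ : Type*) [Fintype κ] [DecidableEq κ] (A : Op ι) : Op (ι ⊕ κ) :=
  (A ⊗ₖ (1 : Op κ)).submatrix (Equiv.sumArrowEquivProdArrow ι κ (Fin 2))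
    (Equiv.sumArrowEquivProdArrow ι κ (Fin 2))

theorem lift_mul (A B : Op ι) : lift κ (A * B) = lift κ A * lift κ B := by
  rw [lift, lift, lift, Matrix.submatrix_mul_equiv, ← Matrix.mul_kronecker_mul, mul_one]

theorem lift_one : lift κ (1 : Op ι) = 1 := by
  rw [lift, Matrix.one_kronecker_one, Matrix.submatrix_one_equiv]

theorem lift_conjTranspose (A : Op ι) : (lift κ A)ᴴ = lift κ Aᴴ := by
  rw [lift, lift, Matrix.conjTranspose_submatrix, Matrix.conjTranspose_kronecker,
    Matrix.conjTranspose_one]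

theorem lift_add (A B : Op ι) : lift κ (A + B) = lift κ A + lift κ B := by
  rw [lift, Matrix.add_kronecker]; rfl

theorem lift_smul (c : ℂ) (A : Op ι) : lift κ (c • A) = c • lift κ A := by
  rw [lift, Matrix.smul_kronecker]; rfl

theorem lift_pauliMat (p : ι → Pauli) :
    lift κ (pauliMat p) = pauliMat (Sum.elim p fun _ => .I) := by
  ext x y
  simp only [lift, Matrix.submatrix_apply, Matrix.kroneckerMap_apply, pauliMat,
    Fintype.prod_sum_type, Sum.elim_inl, Sum.elim_inr]
  rw [← pauliMat_I]
  rfl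

theorem lift_mem_localOps {S : Finset ι} {A : Op ι} (hA : A ∈ localOps S) :
    lift κ A ∈ localOps (S.map Function.Embedding.inl) := by
  induction hA using Submodule.span_induction with
  | mem x hx =>
    obtain ⟨p, hp, rfl⟩ := hx
    rw [lift_pauliMat]
    refine pauliMat_mem_localOps fun i hi => ?_
    cases i with
    | inl i => exact hp i (by simpa using hi)
    | inr i => rfl
  | zero => rw [← zero_smul ℂ (0 : Op ι), lift_smul, zero_smul]; exact Submodule.zero_mem _
  | add x y _ _ hx hy => rw [lift_add]; exact Submodule.add_mem _ hx hy
  | smul r x _ h => rw [lift_smul]; exact Submodule.smul_mem _ _ h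

theorem pauliSgn_sum (p : ι ⊕ κ → Pauli) (q : ι → Pauli) :
    pauliSgn p (Sum.elim q fun _ => .I) = pauliSgn (p ∘ Sum.inl) q := by
  simp [pauliSgn, Fintype.prod_sum_type, Pauli.sgn_I]

theorem trace_mul_lift (ρ : Op (ι ⊕ κ)) (A : Op ι) :
    (lift κ A * ρ).trace = (A * codeMarginal ρ).trace := by
  simp only [Matrix.trace, Matrix.diag_apply, Matrix.mul_apply, codeMarginal, lift,
    Matrix.submatrix_apply, Matrix.kroneckerMap_apply, Finset.mul_sum]
  rw [← Equiv.sum_comp (M := ℂ) (Equiv.sumArrowEquivProdArrow ι κ (Fin 2)).symm,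
    Fintype.sum_prod_type]
  refine Finset.sum_congr rfl fun x _ => ?_
  conv_rhs => rw [Finset.sum_comm]
  refine Finset.sum_congr rfl fun z _ => ?_
  rw [← Equiv.sum_comp (M := ℂ) (Equiv.sumArrowEquivProdArrow ι κ (Fin 2)).symm,
    Fintype.sum_prod_type]
  refine Finset.sum_congr rfl fun y _ => ?_
  simp only [Equiv.apply_symm_apply, Matrix.one_apply, mul_ite, mul_one, mul_zero, ite_mul,
    zero_mul, Finset.sum_ite_eq, Finset.mem_univ, if_true]
  rfl

end

section

variable {ι : Type*} [Fintype ι] [DecidableEq ι]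

/-! ### Light cones -/

/-- The set `S` together with all gates of the list that touch it. -/
def spread : List (Gate ι) → Finset ι → Finset ι
  | [], S => S
  | g :: gs, S => if Disjoint g.qubits S then spread gs S else g.qubits ∪ spread gs S

theorem subset_spread (gs : List (Gate ι)) (S : Finset ι) : S ⊆ spread gs S := by
  induction gs with
  | nil => exact subset_rfl
  | cons g gs ih =>
    rw [spread]
    split_ifs
    · exact ih
    · exact ih.trans Finset.subset_union_right

theorem disjoint_spread {T : Finset ι} (gs : List (Gate ι)) (S : Finset ι) (hT : Disjoint T S)
    (h : ∀ g ∈ gs, Disjoint T g.qubits) : Disjoint T (spread gs S) := by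
  induction gs with
  | nil => exact hT
  | cons g gs ih =>
    have ih := ih fun g' hg' => h g' (List.mem_cons_of_mem _ hg')
    rw [spread]
    split_ifs
    · exact ih
    · exact Finset.disjoint_union_right.2 ⟨h g List.mem_cons_self, ih⟩

/-- The qubits on which the gates of the list act. -/
def gateQubits (gs : List (Gate ι)) : Finset ι := gs.foldr (fun g T => g.qubits ∪ T) ∅

theorem disjoint_gateQubits {T : Finset ι} (gs : List (Gate ι))
    (h : ∀ g ∈ gs, Disjoint T g.qubits) : Disjoint T (gateQubits gs) := by
  induction gs with
  | nil => exact Finset.disjoint_empty_right _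
  | cons g gs ih =>
    exact Finset.disjoint_union_right.2 ⟨h g List.mem_cons_self,
      ih fun g' hg' => h g' (List.mem_cons_of_mem _ hg')⟩

/-- A gate that meets S adds at most one new qubit and uses up at least one qubit of S. The gates
being disjoint, different gates use up different qubits; counting S ∩ `gateQubits` instead of S
makes the induction go through. -/
theorem card_spread_le {gs : List (Gate ι)} (S : Finset ι)
    (hgs : gs.Pairwise fun g h => Disjoint g.qubits h.qubits) :
    (spread gs S).card ≤ S.card + (S ∩ gateQubits gs).card := by
  induction gs with
  | nil => exact Nat.le_add_right _ _
  | cons g gs ih =>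
    rw [List.pairwise_cons] at hgs
    have ih := ih hgs.2
    have hsub : gateQubits gs ⊆ gateQubits (g :: gs) := Finset.subset_union_right
    rw [spread]
    split_ifs with hg
    · exact ih.trans (Nat.add_le_add_left
        (Finset.card_le_card (Finset.inter_subset_inter_left hsub)) _)
    · have h1 : (g.qubits ∪ spread gs S).card ≤ (g.qubits \ S).card + (spread gs S).card := by
        refine le_trans (Finset.card_le_card ?_) (Finset.card_union_le _ _)
        intro i hi
        by_cases hS : i ∈ S
        · exact Finset.mem_union_right _ (subset_spread gs S hS)
        · simpa [hS] using hi
      have h2 : 0 < (g.qubits ∩ S).card :=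
        Finset.card_pos.2 (Finset.not_disjoint_iff_nonempty_inter.1 hg)
      have h3 := Finset.card_sdiff_add_card_inter g.qubits S
      have h4 := g.card_le
      have h5 : (S ∩ gateQubits (g :: gs)).card
          = (g.qubits ∩ S).card + (S ∩ gateQubits gs).card := by
        change (S ∩ (g.qubits ∪ gateQubits gs)).card = _
        rw [Finset.inter_union_distrib_left, Finset.card_union_of_disjoint, Finset.inter_comm]
        exact (disjoint_gateQubits gs hgs.1).mono Finset.inter_subset_right
          Finset.inter_subset_right
      omega

theorem embed_unitary_mul_conjTranspose {S : Finset ι} (V : UOp S) :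
    embed S (V : Op S) * (embed S (V : Op S))ᴴ = 1 := by
  rw [embed_conjTranspose, embed_mul, ← Matrix.star_eq_conjTranspose,
    Unitary.mul_star_self_of_mem V.2, embed_one]

/-- A gate that misses S is disjoint from the other gates too, hence from the whole support built so
far; it commutes with the conjugated operator and cancels against its adjoint. -/
theorem conj_gates_mem_localOps {gs : List (Gate ι)} {S : Finset ι}
    (hgs : gs.Pairwise fun g h => Disjoint g.qubits h.qubits) {M : Op ι} (hM : M ∈ localOps S) :
    (gs.map fun g => embed g.qubits (g.unitary : Op g.qubits)).prod * M
      * ((gs.map fun g => embed g.qubits (g.unitary : Op g.qubits)).prod)ᴴ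
      ∈ localOps (spread gs S) := by
  induction gs with
  | nil => simpa [spread] using hM
  | cons g gs ih =>
    rw [List.pairwise_cons] at hgs
    have ih := ih hgs.2
    set W := (gs.map fun g => embed g.qubits (g.unitary : Op g.qubits)).prod
    rw [List.map_cons, List.prod_cons, conjTranspose_mul]
    set V := embed g.qubits (g.unitary : Op g.qubits)
    have hV : V ∈ localOps g.qubits := embed_mem_localOps _ _
    have e : V * W * M * (Wᴴ * Vᴴ) = V * (W * M * Wᴴ) * Vᴴ := by simp only [mul_assoc]
    rw [e, spread]
    split_ifs with hg
    · rw [(commute_of_mem_localOps (disjoint_spread gs S hg hgs.1) hV ih).eq, mul_assoc,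
        embed_unitary_mul_conjTranspose, mul_one]
      exact ih
    · have hV' := localOps_mono (Finset.subset_union_left (s₂ := spread gs S)) hV
      exact mul_mem_localOps (mul_mem_localOps hV' (localOps_mono Finset.subset_union_right ih))
        (conjTranspose_mem_localOps hV')

/-- The inverse of a gate. -/
def Gate.inv (g : Gate ι) : Gate ι := ⟨g.qubits, g.card_le, star g.unitary⟩

/-- The inverse of a layer. -/
def Layer.inv (L : Layer ι) : Layer ι where
  -- Reversing makes the product literally the adjoint, with no appeal to commuting gates.
  gates := (L.gates.map Gate.inv).reverse
  disjoint := by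
    rw [List.pairwise_reverse, List.pairwise_map]
    exact L.disjoint.imp fun h => h.symm

theorem Layer.op_inv (L : Layer ι) : L.inv.op = L.opᴴ := by
  rw [Layer.op, Layer.op, Matrix.conjTranspose_list_prod, Layer.inv, List.map_reverse,
    List.map_map, List.map_map]
  congr 3
  funext g
  simp [Gate.inv, embed_conjTranspose, Matrix.star_eq_conjTranspose]

theorem Layer.exists_conj_mem (L : Layer ι) (S : Finset ι) :
    ∃ T : Finset ι, T.card ≤ 2 * S.card ∧ ∀ M ∈ localOps S, L.op * M * L.opᴴ ∈ localOps T :=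
  ⟨spread L.gates S, by
    have h := card_spread_le S L.disjoint
    have h' := Finset.card_le_card (Finset.inter_subset_left (s₁ := S) (s₂ := gateQubits L.gates))
    omega, fun _ hM => conj_gates_mem_localOps L.disjoint hM⟩

theorem Layer.op_mul_conjTranspose (L : Layer ι) : L.op * L.opᴴ = 1 := by
  rw [Layer.op]
  induction L.gates with
  | nil => simp
  | cons g gs ih =>
    rw [List.map_cons, List.prod_cons, conjTranspose_mul]
    rw [mul_assoc, ← mul_assoc _ _ (embed _ _)ᴴ, ih, one_mul, embed_unitary_mul_conjTranspose]

theorem Circuit.op_mul_conjTranspose (U : Circuit ι) : U.op * U.opᴴ = 1 := by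
  induction U with
  | nil => simp [Circuit.op]
  | cons L U ih =>
    rw [Circuit.op, conjTranspose_mul, mul_assoc, ← mul_assoc L.op, L.op_mul_conjTranspose,
      one_mul, ih]

theorem Circuit.conjTranspose_mul_op (U : Circuit ι) : U.opᴴ * U.op = 1 :=
  mul_eq_one_comm.1 U.op_mul_conjTranspose

/-- The forward light cone of a set of qubits. -/
theorem Circuit.exists_conj_mem (U : Circuit ι) (S : Finset ι) :
    ∃ T : Finset ι, T.card ≤ 2 ^ U.depth * S.card ∧
      ∀ M ∈ localOps S, U.op * M * U.opᴴ ∈ localOps T := by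
  -- The layer applied first is the innermost conjugation, so the remaining layers start from an
  -- enlarged set. In the backward cone it is outermost, and S can stay fixed.
  induction U generalizing S with
  | nil => exact ⟨S, by simp [Circuit.depth], fun M hM => by simpa [Circuit.op] using hM⟩
  | cons L U ih =>
    obtain ⟨T, hT, h⟩ := L.exists_conj_mem S
    obtain ⟨R, hR, h'⟩ := ih T
    refine ⟨R, ?_, fun M hM => ?_⟩
    · calc R.card ≤ 2 ^ Circuit.depth U * T.card := hR
        _ ≤ 2 ^ Circuit.depth U * (2 * S.card) := Nat.mul_le_mul_left _ hT
        _ = 2 ^ Circuit.depth (L :: U) * S.card := by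
          simp only [Circuit.depth, List.length_cons, pow_succ, mul_assoc]
    · have := h' _ (h M hM)
      simpa only [Circuit.op, conjTranspose_mul, mul_assoc] using this

/-- The backward light cone of a set of qubits. -/
theorem Circuit.exists_conj_mem' (U : Circuit ι) (S : Finset ι) :
    ∃ T : Finset ι, T.card ≤ 2 ^ U.depth * S.card ∧
      ∀ M ∈ localOps S, U.opᴴ * M * U.op ∈ localOps T := by
  induction U with
  | nil => exact ⟨S, by simp [Circuit.depth], fun M hM => by simpa [Circuit.op] using hM⟩
  | cons L U ih =>
    obtain ⟨T, hT, h⟩ := ih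
    obtain ⟨R, hR, h'⟩ := L.inv.exists_conj_mem T
    refine ⟨R, ?_, fun M hM => ?_⟩
    · calc R.card ≤ 2 * T.card := hR
        _ ≤ 2 * (2 ^ Circuit.depth U * S.card) := Nat.mul_le_mul_left _ hT
        _ = 2 ^ Circuit.depth (L :: U) * S.card := by
          simp only [Circuit.depth, List.length_cons, pow_succ]; ring
    · have := h' _ (h M hM)
      simpa only [Circuit.op, Layer.op_inv, conjTranspose_conjTranspose, conjTranspose_mul,
        mul_assoc] using this

/-! ### Projections onto zero -/

/-- The projection of the qubits in `A` onto `|0⟩`. -/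
def zeroProj (A : Finset ι) : Op ι := Matrix.diagonal fun x => if ∀ i ∈ A, x i = 0 then 1 else 0

theorem zeroProj_mem_localOps (A : Finset ι) : zeroProj A ∈ localOps A := by
  have h : zeroProj A = embed A (zeroProj Finset.univ) := by
    ext x y
    by_cases hxy : x = y
    · subst hxy
      simp [zeroProj, embed]
    · have : (∀ i, i ∉ A → x i = y i) → (fun i : A => x i) ≠ fun i : A => y i := by
        intro h e
        refine hxy (funext fun i => ?_)
        by_cases hi : i ∈ A
        · exact congrFun e ⟨i, hi⟩
        · exact h i hi
      simp only [zeroProj, embed, Matrix.diagonal_apply_ne _ hxy]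
      split_ifs with h
      · rw [Matrix.diagonal_apply_ne _ (this h)]
      · rfl
  rw [h]
  exact embed_mem_localOps _ _

theorem zeroProj_conjTranspose (A : Finset ι) : (zeroProj A)ᴴ = zeroProj A := by
  rw [zeroProj, Matrix.diagonal_conjTranspose]
  congr 1
  funext x
  simp only [Pi.star_apply]
  split_ifs <;> simp

theorem zeroProj_mul_self (A : Finset ι) : zeroProj A * zeroProj A = zeroProj A := by
  rw [zeroProj, Matrix.diagonal_mul_diagonal]
  congr 1
  funext x
  split_ifs <;> simp

theorem zeroProj_mulVec_apply (A : Finset ι) (v : Ket ι) (x : Bits ι) :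
    (zeroProj A *ᵥ v) x = if ∀ i ∈ A, x i = 0 then v x else 0 := by
  rw [zeroProj, Matrix.mulVec_diagonal]
  split_ifs <;> simp

theorem zeroProj_mulVec_zeroKet (A : Finset ι) : zeroProj A *ᵥ zeroKet ι = zeroKet ι := by
  funext x
  rw [zeroProj_mulVec_apply]
  by_cases hx : x = 0
  · simp [hx]
  · simp [zeroKet, hx]

/-- An operator local to `B` leaves the qubits outside `B` in the state `|0⟩`. -/
theorem zeroProj_mulVec_mulVec_zeroKet {B : Finset ι} {E : Op ι} (hE : E ∈ localOps B) :
    zeroProj B *ᵥ (E *ᵥ zeroKet ι) = E 0 0 • zeroKet ι := by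
  -- E commutes with the projection outside B, which fixes |0⟩; hence E|0⟩ is still zero outside B.
  have hc : Commute E (zeroProj Bᶜ) :=
    commute_of_mem_localOps disjoint_compl_right hE (zeroProj_mem_localOps _)
  have h : E *ᵥ zeroKet ι = zeroProj Bᶜ *ᵥ (E *ᵥ zeroKet ι) := by
    rw [Matrix.mulVec_mulVec, ← hc.eq, ← Matrix.mulVec_mulVec, zeroProj_mulVec_zeroKet]
  rw [h]
  funext x
  rw [zeroProj_mulVec_apply, zeroProj_mulVec_apply]
  by_cases hx : x = 0
  · subst hx
    simp [zeroKet]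
  · have : ¬ ((∀ i ∈ B, x i = 0) ∧ ∀ i ∈ Bᶜ, x i = 0) := by
      rintro ⟨h1, h2⟩
      refine hx (funext fun i => ?_)
      by_cases hi : i ∈ B
      · exact h1 i hi
      · exact h2 i (Finset.mem_compl.2 hi)
    rw [Pi.smul_apply, zeroKet, Pi.single_eq_of_ne hx, smul_zero]
    split_ifs with h1 h2
    · exact absurd ⟨h1, h2⟩ this
    · rfl
    · rfl

/-! ### Norms of vectors -/

/-- The squared norm of a vector. -/
def nsq (v : Ket ι) : ℝ := ∑ x, Complex.normSq (v x)

theorem nsq_nonneg (v : Ket ι) : 0 ≤ nsq v := Finset.sum_nonneg fun _ _ => Complex.normSq_nonneg _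

theorem star_dotProduct_self (v : Ket ι) : star v ⬝ᵥ v = (nsq v : ℂ) := by
  simp [dotProduct, nsq, Complex.normSq_eq_conj_mul_self]

theorem star_mulVec_dotProduct (M : Op ι) (u v : Ket ι) :
    star (M *ᵥ u) ⬝ᵥ v = star u ⬝ᵥ (Mᴴ *ᵥ v) := by
  rw [Matrix.star_mulVec, ← Matrix.dotProduct_mulVec]

theorem nsq_mulVec_eq (M : Op ι) (v : Ket ι) :
    (nsq (M *ᵥ v) : ℂ) = star v ⬝ᵥ ((Mᴴ * M) *ᵥ v) := by
  rw [← star_dotProduct_self, star_mulVec_dotProduct, Matrix.mulVec_mulVec]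

theorem nsq_isometry {M : Op ι} (hM : Mᴴ * M = 1) (v : Ket ι) : nsq (M *ᵥ v) = nsq v := by
  have h := nsq_mulVec_eq M v
  rw [hM, Matrix.one_mulVec, star_dotProduct_self] at h
  exact_mod_cast h

theorem nsq_add_le (u v : Ket ι) : nsq (u + v) ≤ 2 * nsq u + 2 * nsq v := by
  rw [nsq, nsq, nsq, Finset.mul_sum, Finset.mul_sum, ← Finset.sum_add_distrib]
  refine Finset.sum_le_sum fun x _ => ?_
  rw [Pi.add_apply, Complex.normSq_apply, Complex.normSq_apply, Complex.normSq_apply,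
    Complex.add_re, Complex.add_im]
  nlinarith [sq_nonneg ((u x).re - (v x).re), sq_nonneg ((u x).im - (v x).im)]

theorem nsq_smul (c : ℂ) (v : Ket ι) : nsq (c • v) = Complex.normSq c * nsq v := by
  simp [nsq, Finset.mul_sum]

theorem nsq_zeroKet : nsq (zeroKet ι) = 1 := by
  rw [nsq, Finset.sum_eq_single 0] <;> simp +contextual [zeroKet]

theorem nsq_sub_zeroProj (A : Finset ι) (v : Ket ι) :
    nsq ((1 - zeroProj A) *ᵥ v)
      = ∑ x, if ∀ i ∈ A, x i = 0 then 0 else Complex.normSq (v x) := by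
  refine Finset.sum_congr rfl fun x _ => ?_
  rw [Matrix.sub_mulVec, Matrix.one_mulVec, Pi.sub_apply, zeroProj_mulVec_apply]
  split_ifs <;> simp

theorem nsq_zeroProj_add (A : Finset ι) (v : Ket ι) :
    nsq (zeroProj A *ᵥ v) + nsq ((1 - zeroProj A) *ᵥ v) = nsq v := by
  rw [nsq_sub_zeroProj, nsq, nsq, ← Finset.sum_add_distrib]
  refine Finset.sum_congr rfl fun x _ => ?_
  rw [zeroProj_mulVec_apply]
  split_ifs <;> simp

theorem nsq_sub_zeroProj_le (A : Finset ι) (v : Ket ι) : nsq ((1 - zeroProj A) *ᵥ v) ≤ nsq v := by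
  rw [← nsq_zeroProj_add A v]
  exact le_add_of_nonneg_left (nsq_nonneg _)

theorem nsq_sub_zeroProj_union_le (A B : Finset ι) (v : Ket ι) :
    nsq ((1 - zeroProj (A ∪ B)) *ᵥ v)
      ≤ nsq ((1 - zeroProj A) *ᵥ v) + nsq ((1 - zeroProj B) *ᵥ v) := by
  rw [nsq_sub_zeroProj, nsq_sub_zeroProj, nsq_sub_zeroProj, ← Finset.sum_add_distrib]
  refine Finset.sum_le_sum fun x _ => ?_
  have := Complex.normSq_nonneg (v x)
  split_ifs with h1 h2 h3 h3 h2 h3 h3 <;> try linarith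
  exact absurd (fun i hi => (Finset.mem_union.1 hi).elim (h2 i) (h3 i)) h1

/-- If every set of at most `k` qubits is in the state `|0⟩` up to `c`, then so is every set `B`
up to `(|B| / k + 1) c`. -/
theorem nsq_sub_zeroProj_le_of_card {k : ℕ} (hk : 0 < k) {c : ℝ} (v : Ket ι)
    (h : ∀ A : Finset ι, A.card ≤ k → nsq ((1 - zeroProj A) *ᵥ v) ≤ c) (B : Finset ι) :
    nsq ((1 - zeroProj B) *ᵥ v) ≤ ((B.card : ℝ) / k + 1) * c := by
  have hc : 0 ≤ c := (nsq_nonneg _).trans (h ∅ (by simp))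
  induction B using Finset.strongInduction with
  | H B ih =>
    by_cases hB : B.card ≤ k
    · refine (h B hB).trans (le_mul_of_one_le_left hc ?_)
      exact le_add_of_nonneg_left (by positivity)
    -- Split off a block of exactly k qubits; this lowers |B|/k by one, and the union bound charges
    -- c for the block.
    · obtain ⟨A, hA, hAk⟩ := Finset.exists_subset_card_eq (le_of_not_ge hB)
      have hss : B \ A ⊂ B := by
        refine Finset.sdiff_ssubset hA (Finset.card_pos.1 (by omega))
      have h1 := nsq_sub_zeroProj_union_le A (B \ A) v
      rw [Finset.union_sdiff_of_subset hA] at h1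
      have h2 := ih _ hss
      have h3 := h A hAk.le
      have h4 : ((B \ A).card : ℝ) / k + 1 = (B.card : ℝ) / k := by
        have := Finset.card_sdiff_add_card_eq_card hA
        have hk' : (k : ℝ) ≠ 0 := by positivity
        rw [← this, hAk]
        push_cast
        field_simp
      rw [h4] at h2
      linarith

end

section

variable {ι : Type*} [Fintype ι] [DecidableEq ι]

/-! ### Orthogonal projections and the trace norm -/

theorem nsq_proj_add {P : Op ι} (h1 : Pᴴ = P) (h2 : P * P = P) (v : Ket ι) :
    nsq (P *ᵥ v) + nsq ((1 - P) *ᵥ v) = nsq v := by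
  have h3 : (1 - P)ᴴ * (1 - P) = 1 - P := by
    rw [conjTranspose_sub, conjTranspose_one, h1, mul_sub, sub_mul, sub_mul, h2]
    simp
  have h : ((nsq (P *ᵥ v) + nsq ((1 - P) *ᵥ v) : ℝ) : ℂ) = (nsq v : ℂ) := by
    rw [Complex.ofReal_add, nsq_mulVec_eq, nsq_mulVec_eq, h1, h2, h3, ← dotProduct_add,
      ← Matrix.add_mulVec, add_sub_cancel, Matrix.one_mulVec, star_dotProduct_self]
  exact_mod_cast h

/-- The orthogonal projection is transported from `EuclideanSpace`, because `Ket` itself carries no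
inner product. -/
theorem exists_projection (D : Submodule ℂ (Ket ι)) :
    ∃ P : Op ι, Pᴴ = P ∧ P * P = P ∧ (∀ v, P *ᵥ v ∈ D) ∧ ∀ v ∈ D, P *ᵥ v = v := by
  let K : Submodule ℂ (EuclideanSpace ℂ (Bits ι)) :=
    D.comap (WithLp.linearEquiv 2 ℂ (Ket ι)).toLinearMap
  obtain ⟨M, hM⟩ : ∃ M : Op ι, Matrix.toEuclideanCLM (n := Bits ι) (𝕜 := ℂ) M = K.starProjection :=
    EquivLike.surjective _ _
  have hv : ∀ v : Ket ι, M *ᵥ v = WithLp.ofLp (K.starProjection (WithLp.toLp 2 v)) := by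
    intro v
    rw [← hM, Matrix.ofLp_toEuclideanCLM]
  have hP := isStarProjection_starProjection (𝕜 := ℂ) (U := K)
  refine ⟨M, ?_, ?_, fun v => ?_, fun v hD => ?_⟩
  · apply EquivLike.injective (Matrix.toEuclideanCLM (n := Bits ι) (𝕜 := ℂ))
    rw [← Matrix.star_eq_conjTranspose, map_star, hM]
    exact hP.isSelfAdjoint
  · apply EquivLike.injective (Matrix.toEuclideanCLM (n := Bits ι) (𝕜 := ℂ))
    rw [map_mul, hM]
    exact hP.isIdempotentElem
  · rw [hv]
    exact Submodule.starProjection_apply_mem K _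
  · rw [hv, (Submodule.starProjection_eq_self_iff (K := K)).2 hD]

theorem norm_sq_eq_nsq (v : EuclideanSpace ℂ (Bits ι)) : ‖v‖ ^ 2 = nsq (WithLp.ofLp v) := by
  rw [EuclideanSpace.norm_sq_eq]
  simp [nsq, Complex.normSq_eq_norm_sq]

/-- In an orthonormal eigenbasis b_i of AᴴA, each diagonal entry of PA is at most ‖PAb_i‖ ≤ ‖Ab_i‖,
which is the i-th singular value. -/
theorem norm_trace_mul_le_traceNorm {P : Op ι} (h1 : Pᴴ = P) (h2 : P * P = P) (A : Op ι) :
    ‖(P * A).trace‖ ≤ traceNorm A := by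
  have hA := Matrix.isHermitian_conjTranspose_mul_self A
  have ht : (P * A).trace = LinearMap.trace ℂ _ (Matrix.toEuclideanLin (P * A)) := by
    rw [Matrix.toEuclideanLin_eq_toLin_orthonormal, Matrix.trace_toLin_eq]
  rw [ht, LinearMap.trace_eq_sum_inner _ hA.eigenvectorBasis, traceNorm]
  refine (norm_sum_le _ _).trans (Finset.sum_le_sum fun i _ => ?_)
  refine (norm_inner_le_norm _ _).trans ?_
  rw [OrthonormalBasis.norm_eq_one, one_mul]
  refine Real.le_sqrt_of_sq_le ?_
  have hb : nsq (WithLp.ofLp (hA.eigenvectorBasis i)) = 1 := by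
    rw [← norm_sq_eq_nsq, OrthonormalBasis.norm_eq_one, one_pow]
  have hl : nsq (A *ᵥ WithLp.ofLp (hA.eigenvectorBasis i)) = hA.eigenvalues i := by
    have h := nsq_mulVec_eq A (WithLp.ofLp (hA.eigenvectorBasis i))
    rw [hA.mulVec_eigenvectorBasis, dotProduct_smul, star_dotProduct_self, hb] at h
    have h' : (nsq (A *ᵥ WithLp.ofLp (hA.eigenvectorBasis i)) : ℂ) = (hA.eigenvalues i : ℂ) := by
      rw [h]; simp
    exact_mod_cast h'
  rw [norm_sq_eq_nsq, ← hl]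
  change nsq ((P * A) *ᵥ WithLp.ofLp (hA.eigenvectorBasis i)) ≤ _
  rw [← Matrix.mulVec_mulVec, ← nsq_proj_add h1 h2 (A *ᵥ _)]
  exact le_add_of_nonneg_right (nsq_nonneg _)

theorem trace_mul_ketbra (M : Op ι) (v : Ket ι) : (M * ketbra v).trace = star v ⬝ᵥ (M *ᵥ v) := by
  rw [ketbra, Matrix.mul_vecMulVec, Matrix.trace_vecMulVec, dotProduct_comm]

/-- The uncertainty relation for anti-commuting reflections. -/
theorem normSq_add_normSq_le_one {E F : Op ι} (hE : Eᴴ = E) (hF : Fᴴ = F) (hE2 : E * E = 1)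
    (hF2 : F * F = 1) (hEF : E * F = -(F * E)) (x : Bits ι) :
    Complex.normSq (E x x) + Complex.normSq (F x x) ≤ 1 := by
  have hre : ∀ {M : Op ι}, Mᴴ = M → M x x = ((M x x).re : ℂ) := fun {M} h =>
    (Complex.conj_eq_iff_re.1 (by
      have := congrFun (congrFun h x) x
      rwa [Matrix.conjTranspose_apply] at this)).symm
  obtain ⟨a, ha⟩ : ∃ a : ℝ, E x x = a := ⟨_, hre hE⟩
  obtain ⟨b, hb⟩ : ∃ b : ℝ, F x x = b := ⟨_, hre hF⟩
  -- With a, b the two diagonal entries, M² = (a² + b²)·1 by anti-commutation, so row x of M has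
  -- squared norm a² + b². Its diagonal entry is also a² + b², whence (a² + b²)² ≤ a² + b².
  set M : Op ι := (a : ℂ) • E + (b : ℂ) • F
  have hM : Mᴴ = M := by simp [M, hE, hF]
  have hMx : M x x = ((a ^ 2 + b ^ 2 : ℝ) : ℂ) := by
    simp only [M, Matrix.add_apply, Matrix.smul_apply, ha, hb, smul_eq_mul]
    push_cast; ring
  have hM2 : M * M = ((a ^ 2 + b ^ 2 : ℝ) : ℂ) • 1 := by
    simp only [M, add_mul, mul_add, smul_mul_smul_comm, hE2, hF2, hEF, mul_comm (b : ℂ) a]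
    push_cast
    module
  have hs : ∑ y, Complex.normSq (M x y) = a ^ 2 + b ^ 2 := by
    have h : (Mᴴ * M) x x = ((a ^ 2 + b ^ 2 : ℝ) : ℂ) := by rw [hM, hM2]; simp
    have h' : (M * Mᴴ) x x = ((∑ y, Complex.normSq (M x y) : ℝ) : ℂ) := by
      simp [Matrix.mul_apply, Complex.mul_conj]
    rw [hM] at h h'
    rw [h] at h'
    exact_mod_cast h'.symm
  have h1 := Finset.single_le_sum (f := fun y => Complex.normSq (M x y))
    (fun y _ => Complex.normSq_nonneg _) (Finset.mem_univ x)
  rw [hs, hMx, Complex.normSq_ofReal] at h1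
  rw [ha, hb, Complex.normSq_ofReal, Complex.normSq_ofReal]
  by_contra! h
  nlinarith

end

section

variable {n N a : ℕ}

/-! ### Local indistinguishability -/

theorem UOp.mul_ne_zero {ι : Type*} [Fintype ι] [DecidableEq ι] (P Q : UOp ι) :
    (P : Op ι) * (Q : Op ι) ≠ 0 := by
  intro h
  have h1 := Unitary.star_mul_self_of_mem (P * Q).2
  rw [Submonoid.coe_mul, h, mul_zero] at h1
  exact zero_ne_one h1

theorem not_antiCommute_of_commute {ι : Type*} [Fintype ι] [DecidableEq ι] {P Q : UOp ι}
    (h : Commute P Q) : ¬ AntiCommute P Q := by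
  intro h'
  have h1 : (P : Op ι) * Q = Q * P := congrArg Subtype.val h.eq
  rw [AntiCommute, ← h1, eq_neg_iff_add_eq_zero, ← two_smul ℂ] at h'
  exact UOp.mul_ne_zero P Q ((smul_eq_zero.1 h').resolve_left two_ne_zero)

theorem commute_stabilizer (𝒞 : StabilizerCode n N) {O P : UOp (Fin n)}
    (hO : ∀ i, Commute O (𝒞.check i)) (hP : P ∈ 𝒞.stabilizer) : Commute P O := by
  have h : 𝒞.stabilizer ≤ Subgroup.centralizer {O} := by
    rw [StabilizerCode.stabilizer, Subgroup.closure_le]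
    rintro _ ⟨i, rfl⟩
    rw [SetLike.mem_coe, Subgroup.mem_centralizer_singleton_iff]
    exact (hO i).symm.eq
  exact Subgroup.mem_centralizer_singleton_iff.1 (h hP)

/-- The check is unitary with a real eigenvalue ±1 on v, so its adjoint has the same eigenvalue
there. This covers checks that are not Hermitian. -/
theorem conjTranspose_lift_mulVec {ι κ : Type*} [Fintype ι] [DecidableEq ι] [Fintype κ] [DecidableEq κ]
    {C : UOp ι} {e : ℕ} {v : Ket (ι ⊕ κ)}
    (h : lift κ (C : Op ι) *ᵥ v = (-1 : ℂ) ^ e • v) :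
    (lift κ (C : Op ι))ᴴ *ᵥ v = (-1 : ℂ) ^ e • v := by
  have h1 : (lift κ (C : Op ι))ᴴ *ᵥ (lift κ (C : Op ι) *ᵥ v) = v := by
    rw [Matrix.mulVec_mulVec, lift_conjTranspose, ← lift_mul, ← Matrix.star_eq_conjTranspose,
      Unitary.star_mul_self_of_mem C.2, lift_one, Matrix.one_mulVec]
  rw [h, Matrix.mulVec_smul] at h1
  nth_rw 2 [← h1]
  rw [smul_smul, ← mul_pow]
  simp

/-- A Pauli operator that anti-commutes with a check has expectation zero in every syndrome
space. -/
theorem expectation_eq_zero {ι κ : Type*} [Fintype ι] [DecidableEq ι] [Fintype κ] [DecidableEq κ]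
    {C : UOp ι} {e : ℕ} {v : Ket (ι ⊕ κ)} {M : Op (ι ⊕ κ)}
    (h : lift κ (C : Op ι) *ᵥ v = (-1 : ℂ) ^ e • v)
    (hM : M * lift κ (C : Op ι) = -(lift κ (C : Op ι) * M)) : star v ⬝ᵥ (M *ᵥ v) = 0 := by
  -- The check acts on the right-hand v, or, after passing M with a sign, on the left-hand v, with
  -- the same eigenvalue; the expectation equals its own negative.
  have h1 : (-1 : ℂ) ^ e * (star v ⬝ᵥ (M *ᵥ v)) = -((-1 : ℂ) ^ e * (star v ⬝ᵥ (M *ᵥ v))) := by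
    calc (-1 : ℂ) ^ e * (star v ⬝ᵥ (M *ᵥ v)) = star v ⬝ᵥ ((M * lift κ (C : Op ι)) *ᵥ v) := by
          rw [← Matrix.mulVec_mulVec, h, Matrix.mulVec_smul, dotProduct_smul, smul_eq_mul]
      _ = -(star ((lift κ (C : Op ι))ᴴ *ᵥ v) ⬝ᵥ (M *ᵥ v)) := by
          rw [hM, Matrix.neg_mulVec, dotProduct_neg, star_mulVec_dotProduct,
            conjTranspose_conjTranspose, Matrix.mulVec_mulVec]
      _ = _ := by
          rw [conjTranspose_lift_mulVec h, star_smul, smul_dotProduct, star_pow, star_neg, star_one,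
            smul_eq_mul]
  have h2 := self_eq_neg.1 h1
  exact (mul_eq_zero.1 h2).resolve_left (pow_ne_zero _ (by norm_num))

variable (𝒞 : StabilizerCode n N) {O : UOp (Fin n)} {d : ℕ}

/-- A logical operator `O` acts trivially on the marginals of at most `d - 1` qubits of the
states of a syndrome space, if every logical operator anti-commuting with `O` has weight at
least `d`. -/
theorem expectation_conj_logical (hO : O ∈ 𝒞.logicalOps)
    (hd : ∀ P ∈ 𝒞.logicalOps, AntiCommute P O → d ≤ weight (P : Op (Fin n)))
    {s : Fin N → Fin 2} {v : Ket (Fin n ⊕ Fin a)}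
    (hv : ∀ i, lift (Fin a) (𝒞.check i : Op (Fin n)) *ᵥ v = (-1 : ℂ) ^ (s i : ℕ) • v)
    {R : Finset (Fin n ⊕ Fin a)} (hR : R.card < d) {Q : Op (Fin n ⊕ Fin a)}
    (hQ : Q ∈ localOps R) :
    star (lift (Fin a) (O : Op (Fin n)) *ᵥ v) ⬝ᵥ (Q *ᵥ (lift (Fin a) (O : Op (Fin n)) *ᵥ v))
      = star v ⬝ᵥ (Q *ᵥ v) := by
  obtain ⟨⟨hOP, hOC⟩, -⟩ := hO
  obtain ⟨cO, pO, hpO⟩ := exists_eq_smul_pauliMat hOP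
  choose cC pC hpC using fun i => exists_eq_smul_pauliMat (𝒞.check_mem i)
  have comm : ∀ {q : Fin n ⊕ Fin a → Pauli} {c : ℂ} {r : Fin n → Pauli} {M : UOp (Fin n)},
      (M : Op (Fin n)) = c • pauliMat r → pauliMat q * lift (Fin a) (M : Op (Fin n))
        = pauliSgn (q ∘ Sum.inl) r • (lift (Fin a) (M : Op (Fin n)) * pauliMat q) := by
    intro q c r M hM
    rw [hM, lift_smul, lift_pauliMat, mul_smul_comm, pauliMat_mul_comm, pauliSgn_sum,
      smul_mul_assoc, smul_comm]
  have comm' : ∀ {q : Fin n → Pauli} {c : ℂ} {r : Fin n → Pauli} {M : UOp (Fin n)},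
      (M : Op (Fin n)) = c • pauliMat r → (pauliTensor q : Op (Fin n)) * (M : Op (Fin n))
        = pauliSgn q r • ((M : Op (Fin n)) * (pauliTensor q : Op (Fin n))) := by
    intro q c r M hM
    rw [hM, mul_smul_comm, smul_mul_assoc, smul_comm]
    exact congrArg _ (pauliMat_mul_comm q r)
  induction hQ using Submodule.span_induction with
  | mem x hx =>
    obtain ⟨p, hp, rfl⟩ := hx
    by_cases hc : ∀ i, pauliSgn (p ∘ Sum.inl) (pC i) = 1
    · have hs : pauliSgn (p ∘ Sum.inl) pO = 1 := by
        refine (pauliSgn_eq _ _).resolve_right fun hneg => ?_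
        have hanti : AntiCommute (pauliTensor (p ∘ Sum.inl)) O := by
          rw [AntiCommute, comm' hpO, hneg, neg_one_smul]
        have hlog : pauliTensor (p ∘ Sum.inl) ∈ 𝒞.logicalOps := by
          -- The code part of p is not in the stabilizer group: all elements of that group commute
          -- with O.
          refine ⟨⟨Subgroup.subset_closure ⟨_, rfl⟩, fun i => ?_⟩, fun hstab => ?_⟩
          · refine Subtype.ext ?_
            rw [Submonoid.coe_mul, Submonoid.coe_mul, comm' (hpC i), hc i, one_smul]
          · exact not_antiCommute_of_commute (commute_stabilizer 𝒞 hOC hstab) hanti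
        have h1 := hd _ hlog hanti
        have h2 : weight (pauliTensor (p ∘ Sum.inl) : Op (Fin n))
            ≤ (R.preimage Sum.inl Sum.inl_injective.injOn).card :=
          weight_pauliMat_le fun i hi => hp _ (by simpa using hi)
        have h3 : (R.preimage Sum.inl Sum.inl_injective.injOn).card ≤ R.card :=
          Finset.card_le_card_of_injOn Sum.inl (fun i hi => by simpa using hi)
            Sum.inl_injective.injOn
        omega
      have h := comm (q := p) hpO
      rw [hs, one_smul] at h
      rw [star_mulVec_dotProduct, Matrix.mulVec_mulVec, Matrix.mulVec_mulVec, mul_assoc, h,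
        ← mul_assoc, lift_conjTranspose, ← lift_mul, ← Matrix.star_eq_conjTranspose,
        Unitary.star_mul_self_of_mem O.2, lift_one, one_mul]
    · push Not at hc
      obtain ⟨i, hi⟩ := hc
      have hneg := (pauliSgn_eq (p ∘ Sum.inl) (pC i)).resolve_left hi
      have h := comm (q := p) (hpC i)
      rw [hneg, neg_one_smul] at h
      rw [expectation_eq_zero (hv i) h]
      refine expectation_eq_zero (C := 𝒞.check i) (e := s i) ?_ h
      -- O commutes with the checks, so Ov has the same syndrome as v and its expectation vanishes
      -- as well.
      have hcomm : (𝒞.check i : Op (Fin n)) * O = O * 𝒞.check i :=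
        congrArg Subtype.val (hOC i).symm.eq
      rw [Matrix.mulVec_mulVec, ← lift_mul, hcomm, lift_mul, ← Matrix.mulVec_mulVec, hv i,
        Matrix.mulVec_smul]
  | zero => simp
  | add x y _ _ hx hy => rw [Matrix.add_mulVec, dotProduct_add, hx, hy, Matrix.add_mulVec,
      dotProduct_add]
  | smul r x _ h => rw [Matrix.smul_mulVec, dotProduct_smul, h, Matrix.smul_mulVec,
      dotProduct_smul]

/-- A state of a shallow circuit that is close to a syndrome space almost is an eigenstate of
the logical operators. -/
theorem one_sub_le_normSq_logical (hO : O ∈ 𝒞.logicalOps)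
    (hd : ∀ P ∈ 𝒞.logicalOps, AntiCommute P O → d ≤ weight (P : Op (Fin n)))
    {s : Fin N → Fin 2} {v : Ket (Fin n ⊕ Fin a)}
    (hv : ∀ i, lift (Fin a) (𝒞.check i : Op (Fin n)) *ᵥ v = (-1 : ℂ) ^ (s i : ℕ) • v)
    (U : Circuit (Fin n ⊕ Fin a)) {k : ℕ} (hk : 0 < k) (hkd : 2 ^ U.depth * k < d) :
    1 - ((2 ^ U.depth * weight (O : Op (Fin n)) : ℝ) / k + 1)
        * (4 * nsq (U.op *ᵥ zeroKet (Fin n ⊕ Fin a) - v))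
      ≤ Complex.normSq ((U.opᴴ * lift (Fin a) (O : Op (Fin n)) * U.op) 0 0) := by
  set E := U.opᴴ * lift (Fin a) (O : Op (Fin n)) * U.op with hE
  set z := zeroKet (Fin n ⊕ Fin a)
  set e := U.op *ᵥ z - v with he
  have hUU := U.op_mul_conjTranspose
  have hUU' := U.conjTranspose_mul_op
  have hOO : (lift (Fin a) (O : Op (Fin n)))ᴴ * lift (Fin a) (O : Op (Fin n)) = 1 := by
    rw [lift_conjTranspose, ← lift_mul, ← Matrix.star_eq_conjTranspose,
      Unitary.star_mul_self_of_mem O.2, lift_one]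
  obtain ⟨S, hS, hOS⟩ := exists_mem_localOps_card_eq_weight (O : Op (Fin n))
  obtain ⟨B, hB, hEB⟩ := Circuit.exists_conj_mem' U (S.map Function.Embedding.inl)
  have hEB : E ∈ localOps B := hEB _ (lift_mem_localOps hOS)
  rw [Finset.card_map, hS] at hB
  have hz : nsq (E *ᵥ z) = 1 := by
    rw [hE, ← Matrix.mulVec_mulVec, ← Matrix.mulVec_mulVec, nsq_isometry (by simpa using hUU),
      nsq_isometry hOO, nsq_isometry hUU', nsq_zeroKet]
  -- Write E|0⟩ = U†Ov + U†Oe. The failed test has the same weight on U†Ov as on U†v = |0⟩ − U†e,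
  -- where only e contributes. Each part gives at most ‖e‖², and squaring the sum costs a factor 2,
  -- hence 4.
  have hlocal : ∀ A : Finset (Fin n ⊕ Fin a), A.card ≤ k →
      nsq ((1 - zeroProj A) *ᵥ (E *ᵥ z)) ≤ 4 * nsq e := by
    intro A hA
    obtain ⟨R, hR, hAR⟩ := U.exists_conj_mem A
    have hRd : R.card < d := (hR.trans (Nat.mul_le_mul_left _ hA)).trans_lt hkd
    have hPloc : 1 - zeroProj A ∈ localOps A :=
      Submodule.sub_mem _ (one_mem_localOps _) (zeroProj_mem_localOps A)
    have hPP : (1 - zeroProj A)ᴴ * (1 - zeroProj A) = 1 - zeroProj A := by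
      rw [conjTranspose_sub, conjTranspose_one, zeroProj_conjTranspose, mul_sub, sub_mul, sub_mul,
        zeroProj_mul_self]
      simp
    have hQ : ∀ u, (nsq ((1 - zeroProj A) *ᵥ (U.opᴴ *ᵥ u)) : ℂ)
        = star u ⬝ᵥ ((U.op * (1 - zeroProj A) * U.opᴴ) *ᵥ u) := by
      intro u
      rw [nsq_mulVec_eq, hPP, star_mulVec_dotProduct, conjTranspose_conjTranspose,
        Matrix.mulVec_mulVec, Matrix.mulVec_mulVec, mul_assoc]
    have h1 : nsq ((1 - zeroProj A) *ᵥ (U.opᴴ *ᵥ (lift (Fin a) (O : Op (Fin n)) *ᵥ v)))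
        = nsq ((1 - zeroProj A) *ᵥ (U.opᴴ *ᵥ v)) := by
      have h := expectation_conj_logical 𝒞 hO hd hv hRd (hAR _ hPloc)
      rw [← hQ, ← hQ] at h
      exact_mod_cast h
    have h2 : (1 - zeroProj A) *ᵥ (U.opᴴ *ᵥ v) = -((1 - zeroProj A) *ᵥ (U.opᴴ *ᵥ e)) := by
      have h : v = U.op *ᵥ z - e := by rw [he, sub_sub_cancel]
      rw [h, Matrix.mulVec_sub, Matrix.mulVec_mulVec, hUU', Matrix.one_mulVec, Matrix.mulVec_sub,
        Matrix.sub_mulVec, Matrix.one_mulVec, zeroProj_mulVec_zeroKet, sub_self, zero_sub]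
    have hneg : ∀ u : Ket (Fin n ⊕ Fin a), nsq (-u) = nsq u := fun u => by simp [nsq]
    have hUe : ∀ u, nsq ((1 - zeroProj A) *ᵥ (U.opᴴ *ᵥ u)) ≤ nsq u := fun u =>
      (nsq_sub_zeroProj_le A _).trans_eq (nsq_isometry (by simpa using hUU) u)
    have h3 : E *ᵥ z = U.opᴴ *ᵥ (lift (Fin a) (O : Op (Fin n)) *ᵥ v)
        + U.opᴴ *ᵥ (lift (Fin a) (O : Op (Fin n)) *ᵥ e) := by
      rw [← Matrix.mulVec_add, ← Matrix.mulVec_add, he, add_sub_cancel, hE, ← Matrix.mulVec_mulVec,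
        ← Matrix.mulVec_mulVec]
    have h4 := nsq_add_le
      ((1 - zeroProj A) *ᵥ (U.opᴴ *ᵥ (lift (Fin a) (O : Op (Fin n)) *ᵥ v)))
      ((1 - zeroProj A) *ᵥ (U.opᴴ *ᵥ (lift (Fin a) (O : Op (Fin n)) *ᵥ e)))
    rw [← Matrix.mulVec_add, ← h3, h1, h2, hneg] at h4
    have h5 := hUe e
    have h6 := (hUe (lift (Fin a) (O : Op (Fin n)) *ᵥ e)).trans_eq (nsq_isometry hOO e)
    linarith
  have h1 := nsq_sub_zeroProj_le_of_card hk _ hlocal B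
  have h2 := nsq_zeroProj_add B (E *ᵥ z)
  rw [zeroProj_mulVec_mulVec_zeroKet hEB, nsq_smul, nsq_zeroKet, hz, mul_one] at h2
  have h3 : ((B.card : ℝ) / k + 1) * (4 * nsq e)
      ≤ ((2 ^ U.depth * weight (O : Op (Fin n)) : ℝ) / k + 1) * (4 * nsq e) := by
    have : (B.card : ℝ) ≤ 2 ^ U.depth * weight (O : Op (Fin n)) := by exact_mod_cast hB
    have := nsq_nonneg e
    gcongr
  linarith

/-- The distance of a state from a syndrome space, in terms of the trace norm. -/
theorem exists_near_syndrome {s : Fin N → Fin 2} {ρ : Op (Fin n)} (hρ : IsState ρ)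
    (hs : LiesIn ρ (𝒞.syndromeSpace s)) {φ : Ket (Fin n ⊕ Fin a)} (hφ : nsq φ = 1) :
    ∃ v : Ket (Fin n ⊕ Fin a),
      (∀ i, lift (Fin a) (𝒞.check i : Op (Fin n)) *ᵥ v = (-1 : ℂ) ^ (s i : ℕ) • v) ∧
      nsq (φ - v) ≤ traceNorm (codeMarginal (ketbra φ) - ρ) := by
  obtain ⟨P, hP1, hP2, hPD, hPv⟩ := exists_projection (𝒞.syndromeSpace s)
  have hL1 : (lift (Fin a) P)ᴴ = lift (Fin a) P := by rw [lift_conjTranspose, hP1]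
  have hL2 : lift (Fin a) P * lift (Fin a) P = lift (Fin a) P := by rw [← lift_mul, hP2]
  refine ⟨lift (Fin a) P *ᵥ φ, fun i => ?_, ?_⟩
  · have h : (𝒞.check i : Op (Fin n)) * P = (-1 : ℂ) ^ (s i : ℕ) • P := by
      refine Matrix.ext_of_mulVec_single fun x => ?_
      rw [← Matrix.mulVec_mulVec, Matrix.smul_mulVec]
      exact hPD _ i
    rw [Matrix.mulVec_mulVec, ← lift_mul, h, lift_smul, Matrix.smul_mulVec]
  · have h1 := nsq_proj_add hL1 hL2 φ
    rw [Matrix.sub_mulVec, Matrix.one_mulVec, hφ] at h1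
    have h2 : (P * codeMarginal (ketbra φ)).trace = (nsq (lift (Fin a) P *ᵥ φ) : ℂ) := by
      rw [← trace_mul_lift, trace_mul_ketbra, nsq_mulVec_eq, hL1, hL2]
    have h3 : P * ρ = ρ := by
      refine Matrix.ext_of_mulVec_single fun x => ?_
      rw [← Matrix.mulVec_mulVec]
      exact hPv _ (hs _)
    -- Since tr(Pρ) = 1, the trace of P against the difference is ‖Pφ‖² − 1 = −‖φ − Pφ‖².
    have h4 := norm_trace_mul_le_traceNorm hP1 hP2 (codeMarginal (ketbra φ) - ρ)
    rw [mul_sub, Matrix.trace_sub, h2, h3, hρ.2] at h4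
    have h5 : (nsq (lift (Fin a) P *ᵥ φ) : ℂ) - 1 = ((-nsq (φ - lift (Fin a) P *ᵥ φ) : ℝ) : ℂ) := by
      rw [eq_sub_of_add_eq h1]; push_cast; ring
    rw [h5, Complex.norm_real, norm_neg, Real.norm_eq_abs, abs_of_nonneg (nsq_nonneg _)] at h4
    exact h4

/-! ### The numerical estimate. -/

/-- X̄ itself competes in the minimum, as it anti-commutes with Z̄. -/
theorem pairDistance_le_pairWeight {X Z : UOp (Fin n)} (h : 𝒞.IsLogicalPair X Z) :
    𝒞.pairDistance X Z ≤ pairWeight X Z :=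
  (show 𝒞.pairDistance X Z ≤ weight (X : Op (Fin n)) from
    Nat.sInf_le ⟨X, h.left_mem, Or.inr h.anti, rfl⟩).trans (le_max_left _ _)

/-- Multiply the hypothesis by y = d/(T²w) ≤ 1. Since (Tw/k)·y = d/(Tk) ≤ 3, this gives y ≤ 8δ(3 +
1) = 32δ, and (y/64)² ≤ y/64 ≤ δ. -/
theorem sq_le_of_uncertainty {k d w T : ℕ} {δ : ℝ} (hd : 0 < d) (hT : 0 < T) (hdw : d ≤ w)
    (hkd : d ≤ 3 * (T * k)) (hδ : 0 ≤ δ)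
    (h : 1 ≤ 2 * ((((T : ℝ) * w) / k + 1) * (4 * δ))) :
    ((d : ℝ) / (((T : ℝ) * T * 64) * w)) ^ 2 ≤ δ := by
  have hd' : (1 : ℝ) ≤ d := by exact_mod_cast hd
  have hT' : (1 : ℝ) ≤ T := by exact_mod_cast hT
  have hdw' : (d : ℝ) ≤ w := by exact_mod_cast hdw
  have hkd' : (d : ℝ) ≤ 3 * (T * k) := by exact_mod_cast hkd
  have hk : (0 : ℝ) < k := by
    rcases Nat.eq_zero_or_pos k with rfl | hk
    · simp at hkd; omega
    · exact_mod_cast hk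
  have hw : (0 : ℝ) < w := by linarith
  set y : ℝ := d / (T * T * w) with hy
  have hy0 : 0 < y := by positivity
  have hy1 : y ≤ 1 := by
    rw [hy, div_le_one (by positivity)]
    nlinarith [mul_le_mul hT' hT' zero_le_one (by linarith)]
  have h1 : (T : ℝ) * w / k * y ≤ 3 := by
    have : (T : ℝ) * w / k * y = d / (T * k) := by rw [hy]; field_simp
    rw [this, div_le_iff₀ (by positivity)]
    exact hkd'
  have h2 : y ≤ 32 * δ := by
    have := mul_le_mul_of_nonneg_right h hy0.le
    nlinarith
  have h3 : (d : ℝ) / (((T : ℝ) * T * 64) * w) = y / 64 := by rw [hy]; field_simp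
  rw [h3]
  nlinarith

end

end

end QCode

/-! ### Assembling the bound. -/

theorem mainTheorem9 {n N a : ℕ} (𝒞 : QCode.StabilizerCode n N)
    (X Z : QCode.UOp (Fin n)) (hXZ : 𝒞.IsLogicalPair X Z)
    (U : QCode.Circuit (Fin n ⊕ Fin a)) (t : ℕ) (hdepth : U.depth = t)
    (ht : (t : ℝ) ≤ Real.logb 2 ((𝒞.pairDistance X Z : ℝ) / 2))
    (s : Fin N → Fin 2) (ρ : QCode.Op (Fin n)) (hρ : QCode.IsState ρ)
    (hs : QCode.LiesIn ρ (𝒞.syndromeSpace s)) :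
    (1 / 2 : ℝ) *
        ((𝒞.pairDistance X Z : ℝ) / ((2 : ℝ) ^ (2 * t + 6) * (QCode.pairWeight X Z : ℝ))) ^ 2
      ≤ (1 / 2 : ℝ) * QCode.traceNorm
          (QCode.codeMarginal (QCode.ketbra (U.op.mulVec (QCode.zeroKet (Fin n ⊕ Fin a)))) - ρ) := by
  refine mul_le_mul_of_nonneg_left ?_ (by norm_num)
  obtain ⟨v, hv, hδ⟩ := QCode.exists_near_syndrome 𝒞 hρ hs
    (φ := U.op.mulVec (QCode.zeroKet (Fin n ⊕ Fin a)))
    (by rw [QCode.nsq_isometry U.conjTranspose_mul_op, QCode.nsq_zeroKet])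
  refine le_trans ?_ hδ
  have hδ0 := QCode.nsq_nonneg (U.op.mulVec (QCode.zeroKet (Fin n ⊕ Fin a)) - v)
  obtain ⟨d, hd⟩ : ∃ d, 𝒞.pairDistance X Z = d := ⟨_, rfl⟩
  -- `Real.logb 2 0 = 0`, so the depth hypothesis alone does not exclude d = 0; there the bound is
  -- trivial.
  rcases Nat.eq_zero_or_pos d with rfl | hd0
  · simpa [hd] using hδ0
  have hd0' : (0 : ℝ) < d := by exact_mod_cast hd0
  have hdw := QCode.pairDistance_le_pairWeight 𝒞 hXZ
  have hT : 2 * 2 ^ t ≤ d := by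
    rw [hd, Real.le_logb_iff_rpow_le one_lt_two (by positivity), Real.rpow_natCast,
      le_div_iff₀ two_pos] at ht
    rw [mul_comm]
    exact_mod_cast ht
  rw [hd] at hdw ⊢
  -- The largest k with 2^t·k < d. The depth hypothesis 2·2^t ≤ d makes it positive, and then d ≤
  -- 2·2^t·k, within the factor 3 needed below.
  obtain ⟨k, hk⟩ : ∃ k, (d - 1) / 2 ^ t = k := ⟨_, rfl⟩
  have hTpos : 0 < 2 ^ t := by positivity
  have hdiv := Nat.div_add_mod (d - 1) (2 ^ t)
  have hmod := Nat.mod_lt (d - 1) hTpos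
  rw [hk] at hdiv
  have hk0 : 0 < k := by
    rw [← hk]
    exact Nat.div_pos (by omega) hTpos
  have hTk : 2 ^ t ≤ 2 ^ t * k := Nat.le_mul_of_pos_right _ hk0
  have hbound : ∀ O ∈ 𝒞.logicalOps, (QCode.weight (O : QCode.Op (Fin n)) ≤ QCode.pairWeight X Z) →
      (∀ P ∈ 𝒞.logicalOps, QCode.AntiCommute P O → d ≤ QCode.weight (P : QCode.Op (Fin n))) →
      1 - ((((2 ^ t : ℕ) : ℝ) * QCode.pairWeight X Z) / k + 1)
          * (4 * QCode.nsq (U.op.mulVec (QCode.zeroKet (Fin n ⊕ Fin a)) - v))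
        ≤ Complex.normSq
          ((U.op.conjTranspose * QCode.lift (Fin a) (O : QCode.Op (Fin n)) * U.op) 0 0) := by
    intro O hO hw hdO
    refine le_trans ?_ (QCode.one_sub_le_normSq_logical 𝒞 hO hdO hv U hk0
      (by rw [hdepth]; omega))
    rw [hdepth]
    push_cast
    gcongr
  have hX := hbound X hXZ.left_mem (le_max_left _ _) fun P hP h =>
    hd ▸ Nat.sInf_le ⟨P, hP, Or.inl h, rfl⟩
  have hZ := hbound Z hXZ.right_mem (le_max_right _ _) fun P hP h =>
    hd ▸ Nat.sInf_le ⟨P, hP, Or.inr h, rfl⟩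
  have hmul : ∀ A B : QCode.Op (Fin n),
      (U.op.conjTranspose * QCode.lift (Fin a) A * U.op)
        * (U.op.conjTranspose * QCode.lift (Fin a) B * U.op)
      = U.op.conjTranspose * QCode.lift (Fin a) (A * B) * U.op := by
    intro A B
    rw [QCode.lift_mul]
    calc _ = U.op.conjTranspose * QCode.lift (Fin a) A * (U.op * U.op.conjTranspose)
          * QCode.lift (Fin a) B * U.op := by simp only [mul_assoc]
      _ = _ := by rw [U.op_mul_conjTranspose, mul_one]; simp only [mul_assoc]
  have hself : ∀ A : QCode.UOp (Fin n), A * A = 1 →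
      (U.op.conjTranspose * QCode.lift (Fin a) (A : QCode.Op (Fin n)) * U.op).conjTranspose
        = U.op.conjTranspose * QCode.lift (Fin a) (A : QCode.Op (Fin n)) * U.op := by
    intro A hA
    have h : (A : QCode.Op (Fin n)).conjTranspose = A :=
      congrArg Subtype.val (inv_eq_of_mul_eq_one_left hA)
    rw [Matrix.conjTranspose_mul, Matrix.conjTranspose_mul, QCode.lift_conjTranspose, h,
      Matrix.conjTranspose_conjTranspose, mul_assoc]
  have hsq : ∀ A : QCode.UOp (Fin n), A * A = 1 →
      (U.op.conjTranspose * QCode.lift (Fin a) (A : QCode.Op (Fin n)) * U.op)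
        * (U.op.conjTranspose * QCode.lift (Fin a) (A : QCode.Op (Fin n)) * U.op) = 1 := by
    intro A hA
    have h : (A : QCode.Op (Fin n)) * A = 1 := congrArg Subtype.val hA
    rw [hmul, h, QCode.lift_one, mul_one, U.conjTranspose_mul_op]
  have hanti : (X : QCode.Op (Fin n)) * Z = (-1 : ℂ) • ((Z : QCode.Op (Fin n)) * X) := by
    rw [neg_one_smul]; exact hXZ.anti
  -- Conjugation by U preserves being a reflection and anti-commutation; the entry at 0 is the
  -- expectation in |0⟩.
  have huncert := QCode.normSq_add_normSq_le_one (hself X hXZ.left_sq) (hself Z hXZ.right_sq)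
    (hsq X hXZ.left_sq) (hsq Z hXZ.right_sq)
    (by rw [hmul, hmul, hanti, QCode.lift_smul, mul_smul_comm, smul_mul_assoc, neg_one_smul]) 0
  have hfinal := QCode.sq_le_of_uncertainty (k := k) (w := QCode.pairWeight X Z) hd0 hTpos hdw
    (by omega) hδ0 (by linarith)
  have hpow : (2 : ℝ) ^ (2 * t + 6) = ((2 ^ t : ℕ) : ℝ) * ((2 ^ t : ℕ) : ℝ) * 64 := by
    push_cast; ring
  rw [hpow]
  exact hfinal
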